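/- Let $L$ be a countable first-order language (with relation, function and constant symbols), and let $\mathcal M$ be a countably infinite $L$-structure. For a finite (possibly empty) tuple $\mathbf a$ of elements of $\mathcal M$, let $\mathrm{dcl}_{\mathcal M}(\mathbf a)$ be the set of all $b\in\mathcal M$ that are fixed by every automorphism of $\mathcal M$ fixing each entry of $\mathbf a$; say that $\mathcal M$ has trivial definable closure if, for every finite tuple $\mathbf a$, $\mathrm{dcl}_{\mathcal M}(\mathbf a)$ is exactly the set of entries of $\mathbf a$. Let $S_L$ be the set of $L$-structures with underlying set $\mathbb N$, equipped with the $\sigma$-algebra generated by the sets $\{\mathcal N : R^{\mathcal N}(n_1,\dots,n_j)\}$, $\{\mathcal N : f^{\mathcal N}(n_1,\dots,n_k)=\ell\}$ and $\{\mathcal N : c^{\mathcal N}=\ell\}$, where $R$, $f$ and $c$ range over the relation, function and constant symbols of $L$ and $n_1,n_2,\dots,\ell\in\mathbb N$. The group $\mathrm{Sym}(\mathbb N)$ of all permutations of $\mathbb N$ acts on $S_L$ by transport of structure. If $\mathcal M$ has trivial definable closure, then there is a probability measure $\mu$ on $S_L$ that is invariant under the action of $\mathrm{Sym}(\mathbb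 N)$ and is concentrated on $\mathcal M$; that is, the isomorphism class $\{\mathcal N\in S_L : \mathcal N\cong\mathcal M\}$ is a measurable set and $\mu(\{\mathcal N\in S_L : \mathcal N\cong\mathcal M\})=1$. In particular, this holds for every countable relational language $L$. -/

import Mathlib

open FirstOrder

universe u v w

namespace FirstOrder.Language


/-- The space `S_L` of `L`-structures with underlying set `ℕ`. -/
def StructureSpace (L : Language.{u, v}) : Type (max u v) := L.Structure ℕ

namespace StructureSpace

/-- The Borel σ-algebra on `S_L`, generated by the sets `{𝒩 | R^𝒩(n₁, …, n_j)}` for relation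
symbols `R` and the sets `{𝒩 | f^𝒩(n₁, …, n_k) = ℓ}` for function symbols `f`
(constant symbols are the function symbols of arity `0`). -/
instance instMeasurableSpace (L : Language.{u, v}) : MeasurableSpace (StructureSpace L) :=
  MeasurableSpace.generateFrom
    ({X | ∃ (j : ℕ) (R : L.Relations j) (n : Fin j → ℕ),
        X = {𝒩 : StructureSpace L | @Structure.RelMap L ℕ 𝒩 j R n}} ∪
      {X | ∃ (k : ℕ) (f : L.Functions k) (n : Fin k → ℕ) (l : ℕ),
        X = {𝒩 : StructureSpace L | @Structure.funMap L ℕ 𝒩 k f n = l}})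

/-- The logic action of the permutation group of `ℕ` on `S_L`: `g • 𝒩` is the structure obtained
by transporting `𝒩` along `g`, so that `g : 𝒩 → g • 𝒩` is an isomorphism. -/
instance instMulAction (L : Language.{u, v}) :
    MulAction (Equiv.Perm ℕ) (StructureSpace L) where
  smul g 𝒩 :=
    ({ funMap := fun {k} f x => g (@Structure.funMap L ℕ 𝒩 k f (fun i => g.symm (x i)))
       RelMap := fun {j} R x => @Structure.RelMap L ℕ 𝒩 j R (fun i => g.symm (x i)) } :
      L.Structure ℕ)
  one_smul _ := rfl
  mul_smul _ _ _ := rfl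

/-- The isomorphism class of an `L`-structure `M` in `S_L`. -/
def isoClass (L : Language.{u, v}) (M : Type w) [instM : L.Structure M] :
    Set (StructureSpace L) :=
  {𝒩 | Nonempty (@Language.Equiv L ℕ M 𝒩 instM)}

end StructureSpace

/-- The (group-theoretic) definable closure of a finite tuple `a` in `M`: the elements fixed by
every automorphism of `M` that fixes `a` pointwise. -/
def dcl (L : Language.{u, v}) {M : Type w} [L.Structure M] {n : ℕ} (a : Fin n → M) : Set M :=
  {b | ∀ g : M ≃[L] M, (∀ i, g (a i) = a i) → g b = b}

/-- `M` has trivial definable closure: the definable closure of each finite tuple (including the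
empty one) consists only of the entries of the tuple. -/
def HasTrivialDcl (L : Language.{u, v}) (M : Type w) [L.Structure M] : Prop :=
  ∀ (n : ℕ) (a : Fin n → M), dcl L a = Set.range a

/-- `μ` is concentrated on `X`: the set `X` is Borel and `μ(X) = 1`. -/
def IsConcentratedOn {α : Type w} [MeasurableSpace α] (μ : MeasureTheory.Measure α)
    (X : Set α) : Prop :=
  MeasurableSet X ∧ μ X = 1

end FirstOrder.Language

/-! The points of ℕ are labelled by independent random branches of a tree whose levels are finite
subsets of `M`. The labels at level s pull the structure of `M` back to ℕ, and the random structure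
is the limit as s grows. Independent identically distributed branches are exchangeable and the limit
commutes with relabelling, so the law is invariant. It remains to obtain `M` almost surely.

Trivial definable closure is what permits branching. An element outside a finite set can be moved by
an automorphism fixing that set, so every node splits into an original and a clone, with all
simultaneous choices conjugate (`HasTrivialDcl.exists_clones`). Hence finitely many branches that
are separated and carry elements keep the same type, meaning the same orbit under automorphisms, at
all later levels (`exists_coherent`). An extra node `none`, carrying no element, supplies later the
witnesses that the extension property of `M` requires. Generic branches separate pairwise and follow
every finite word, and back-and-forth then identifies the limit with `M`
(`IsGeneric.isApproximation`, `IsApproximation.exists_limitStructure_equiv`). Genericity is almost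
sure by Borel–Cantelli (`ae_isGeneric`).

Function symbols cause no trouble: each value is one of the arguments, so a limit value is a choice
of argument position.

The isomorphism class is Borel by Lusin–Souslin: it is the injective image of a Borel set of maps ℕ
→ `M`, one canonical map for each structure (`injOn_limitStructure_const`). -/

namespace FirstOrder.Language

/-! ### Cloning elements and building the tree of finite levels -/

section Levels

variable {L : Language.{u, v}} {M : Type w} [L.Structure M]

theorem HasTrivialDcl.exists_moving (hM : HasTrivialDcl L M) (F : Finset M) {b : M}
    (hb : b ∉ F) : ∃ g : M ≃[L] M, (∀ a ∈ F, g a = a) ∧ g b ≠ b := by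
  have h := hM F.card (fun i => (F.equivFin.symm i : M))
  have hb' : b ∉ dcl L (fun i => (F.equivFin.symm i : M)) := by
    rw [h]
    rintro ⟨i, rfl⟩
    exact hb (F.equivFin.symm i).2
  simp only [dcl, Set.mem_ofPred_eq, not_forall] at hb'
  obtain ⟨g, hg, hgb⟩ := hb'
  refine ⟨g, fun a ha => ?_, hgb⟩
  simpa using hg (F.equivFin ⟨a, ha⟩)

/-- An automorphism fixing the arguments fixes the value. For `k = 0` the range is empty, which
rules out constants. -/
theorem HasTrivialDcl.funMap_mem_range (hM : HasTrivialDcl L M) {k : ℕ} (f : L.Functions k)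
    (x : Fin k → M) : Structure.funMap f x ∈ Set.range x := by
  rw [← hM k x]
  intro g hg
  rw [g.map_fun]
  congr 1
  exact funext hg

theorem HasTrivialDcl.nonempty_fin (hM : HasTrivialDcl L M) {k : ℕ} (f : L.Functions k) [Nonempty M] :
    Nonempty (Fin k) := by
  obtain ⟨m⟩ := ‹Nonempty M›
  obtain ⟨i, -⟩ := hM.funMap_mem_range f (fun _ => m)
  exact ⟨i⟩

/-- Every element of a finite set can be cloned, all choices between originals and clones being
conjugate under automorphisms. -/
theorem HasTrivialDcl.exists_clones (hM : HasTrivialDcl L M) (A B : Finset M) (hBA : B ⊆ A) :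
    ∃ c : M → M, Set.InjOn c B ∧ (∀ b ∈ B, c b ∉ A) ∧
      ∀ D ⊆ B, ∃ g : M ≃[L] M, (∀ a ∈ D, g a = c a) ∧ ∀ a ∈ A, a ∉ D → g a = a := by
  classical
  induction B using Finset.induction_on with
  | empty =>
    refine ⟨id, by simp, by simp, fun D hD => ⟨Equiv.refl L M, fun a ha => ?_, fun a _ _ => rfl⟩⟩
    exact rfl
  | insert b B hb ih =>
    obtain ⟨c, hinj, hcA, hc⟩ := ih ((Finset.subset_insert _ _).trans hBA)
    have hbA : b ∈ A := hBA (Finset.mem_insert_self _ _)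
    have hBA' : B ⊆ A := (Finset.subset_insert _ _).trans hBA
    -- The clone of `b` will be `h b`. Since `h` fixes the rest of `A` and the earlier clones,
    -- composing with `h` adds the choice at `b` without disturbing the others.
    obtain ⟨h, hfix, hmove⟩ := hM.exists_moving (A.erase b ∪ B.image c) (b := b) (by
      simp only [Finset.mem_union, Finset.mem_erase, ne_eq, not_true_eq_false, false_and,
        Finset.mem_image, false_or, not_exists, not_and]
      intro x hx hxb
      exact hcA x hx (hxb ▸ hbA))
    have hfixA : ∀ a ∈ A, a ≠ b → h a = a := fun a ha hab =>
      hfix a (Finset.mem_union_left _ (Finset.mem_erase.2 ⟨hab, ha⟩))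
    have hfixc : ∀ a ∈ B, h (c a) = c a := fun a ha =>
      hfix _ (Finset.mem_union_right _ (Finset.mem_image_of_mem c ha))
    have hne : ∀ x ∈ B, x ≠ b := fun x hx hxb => hb (hxb ▸ hx)
    have hup : ∀ x ∈ B, Function.update c b (h b) x = c x := fun x hx =>
      Function.update_of_ne (hne x hx) _ _
    have hcb : ∀ x ∈ B, h b ≠ c x := by
      intro x hx hxb
      rw [← hfixc x hx] at hxb
      exact hcA x hx (h.injective hxb ▸ hbA)
    refine ⟨Function.update c b (h b), ?_, ?_, ?_⟩
    · intro x hx y hy hxy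
      rw [Finset.mem_coe, Finset.mem_insert] at hx hy
      rcases hx with rfl | hx <;> rcases hy with rfl | hy
      · rfl
      · rw [hup y hy, Function.update_self] at hxy
        exact (hcb y hy hxy).elim
      · rw [hup x hx, Function.update_self] at hxy
        exact (hcb x hx hxy.symm).elim
      · rw [hup x hx, hup y hy] at hxy
        exact hinj hx hy hxy
    · intro x hx
      rcases Finset.mem_insert.1 hx with rfl | hx
      · rw [Function.update_self]
        intro hA
        by_cases hxx : h x = x
        · exact hmove hxx
        · exact hxx (h.injective (hfixA _ hA hxx))
      · rw [hup x hx]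
        exact hcA x hx
    · intro D hD
      by_cases hbD : b ∈ D
      · obtain ⟨g, hg1, hg2⟩ := hc (D.erase b) (by
          intro x hx
          rw [Finset.mem_erase] at hx
          exact (Finset.mem_insert.1 (hD hx.2)).resolve_left hx.1)
        refine ⟨h.comp g, fun a ha => ?_, fun a ha haD => ?_⟩
        · by_cases hab : a = b
          · subst hab
            rw [Equiv.comp_apply, hg2 a hbA (by simp), Function.update_self]
          · have haB : a ∈ B := (Finset.mem_insert.1 (hD ha)).resolve_left hab
            rw [Equiv.comp_apply, hg1 a (Finset.mem_erase.2 ⟨hab, ha⟩), hup a haB, hfixc a haB]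
        · have hab : a ≠ b := fun hab => haD (hab ▸ hbD)
          rw [Equiv.comp_apply, hg2 a ha (fun h' => haD (Finset.mem_of_mem_erase h')),
            hfixA a ha hab]
      · have hDB : D ⊆ B := fun x hx =>
          (Finset.mem_insert.1 (hD hx)).resolve_left (fun hxb => hbD (hxb ▸ hx))
        obtain ⟨g, hg1, hg2⟩ := hc D hDB
        exact ⟨g, fun a ha => by rw [hg1 a ha, hup a (hDB ha)], hg2⟩

/-- `st` is a branching step from the finite level `A` to the finite level `A'`: each node has
several children, all choices of children of the nodes of `A` are conjugate to `A`, and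
the children of the extra node `none` realise over the old nodes all types of elements of `E`. -/
structure IsLevelStep (L : Language.{u, v}) {M : Type w} [L.Structure M] (A E A' : Finset M)
    (st : Option M → ℕ → Option M) : Prop where
  mem : ∀ u k, (∀ a ∈ u, a ∈ A) → ∀ a ∈ st u k, a ∈ A'
  none_zero : st none 0 ≠ none
  none_none : ∃ k, st none k = none
  inj : ∀ u v k l, (∀ a ∈ u, a ∈ A) → (∀ a ∈ v, a ∈ A) → st u k = st v l → u = v
  sep : ∀ u, (∀ a ∈ u, a ∈ A) → st u 0 ≠ st u 1
  coherent : ∀ k : M → ℕ, ∃ g : M ≃[L] M, ∀ a ∈ A, st (some a) (k a) = some (g a)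
  extend : ∀ g : M ≃[L] M, ∃ g' : M ≃[L] M,
    (∀ a ∈ A, ∀ k, ∀ x ∈ st (some a) k, g x ∈ E → g' x = g x) ∧ ∀ m ∈ E, g'.symm m ∈ A'
  surj : ∀ a ∈ A', ∃ u k, (∀ b ∈ u, b ∈ A) ∧ st u k = some a

/-- Automorphisms induce only finitely many partial maps from `C` to `E`. One representative for
each suffices, and `A'` collects the preimages of `E` under them. -/
theorem exists_finset_extending (C E : Finset M) : ∃ A' : Finset M,
    ∀ g : M ≃[L] M, ∃ g' : M ≃[L] M, (∀ x ∈ C, g x ∈ E → g' x = g x) ∧ ∀ m ∈ E, g'.symm m ∈ A' := by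
  classical
  let φ : (M ≃[L] M) → (C → Option E) := fun g x =>
    if h : g x ∈ E then some ⟨g x, h⟩ else none
  let r : (C → Option E) → (M ≃[L] M) := Function.invFun φ
  refine ⟨Finset.univ.biUnion fun p => E.image (r p).symm, fun g => ⟨r (φ g), ?_, ?_⟩⟩
  · intro x hx hgx
    have h : φ (r (φ g)) ⟨x, hx⟩ = φ g ⟨x, hx⟩ := congrFun (Function.invFun_eq ⟨g, rfl⟩) _
    simp only [φ, dif_pos hgx] at h
    split_ifs at h
    simpa using h
  · intro m hm
    exact Finset.mem_biUnion.2 ⟨φ g, Finset.mem_univ _, Finset.mem_image_of_mem _ hm⟩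

theorem HasTrivialDcl.exists_isLevelStep [Infinite M] (hM : HasTrivialDcl L M) (A E : Finset M) :
    ∃ (A' : Finset M) (st : Option M → ℕ → Option M), IsLevelStep L A E A' st := by
  classical
  obtain ⟨c, hinj, hcA, hc⟩ := hM.exists_clones A A subset_rfl
  obtain ⟨A₁, hA₁⟩ := exists_finset_extending (L := L) (A ∪ A.image c) E
  -- The point `x` only ensures that `N` is nonempty, so that the first child of `none` carries an
  -- element.
  obtain ⟨x, hx⟩ := Infinite.exists_notMem_finset (A ∪ A.image c)
  set C := A ∪ A.image c with hC
  set N : Finset M := insert x A₁ \ C with hN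
  have hxN : x ∈ N := by simp [hN, hx]
  -- Past the end of the list the lookup returns `none`, so the extra node survives at the next
  -- level.
  let st : Option M → ℕ → Option M := fun u k =>
    match u with
    | none => N.toList[k]?
    | some a => if k = 0 then some a else some (c a)
  have st_some : ∀ a k, st (some a) k = if k = 0 then some a else some (c a) := fun _ _ => rfl
  have st_none : ∀ k, st none k = N.toList[k]? := fun _ => rfl
  have mem_C : ∀ a ∈ A, ∀ k, ∀ y ∈ st (some a) k, y ∈ C := by
    intro a ha k y hy
    rw [st_some] at hy
    split_ifs at hy
    · cases hy
      exact Finset.mem_union_left _ ha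
    · cases hy
      exact Finset.mem_union_right _ (Finset.mem_image_of_mem c ha)
  have mem_N : ∀ k, ∀ y ∈ st none k, y ∈ N := by
    intro k y hy
    exact Finset.mem_toList.1 (List.mem_of_getElem? hy)
  have inj_some : ∀ a ∈ A, ∀ b ∈ A, ∀ k l, st (some a) k = st (some b) l → a = b := by
    intro a ha b hb k l h
    rw [st_some, st_some] at h
    split_ifs at h
    · exact Option.some.inj h
    · exact (hcA b hb (Option.some.inj h ▸ ha)).elim
    · exact (hcA a ha ((Option.some.inj h).symm ▸ hb)).elim
    · exact hinj ha hb (Option.some.inj h)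
  have st_ne : ∀ a ∈ A, ∀ k l, st (some a) k ≠ st none l := by
    intro a ha k l h
    obtain ⟨y, hy⟩ : ∃ y, st (some a) k = some y := by
      rw [st_some]
      split_ifs <;> exact ⟨_, rfl⟩
    exact (Finset.mem_sdiff.1 (mem_N l y (h ▸ hy))).2 (mem_C a ha k y hy)
  have hlen : 0 < N.toList.length := by
    rw [Finset.length_toList]
    exact Finset.card_pos.2 ⟨x, hxN⟩
  refine ⟨C ∪ N, st, ?_, ?_, ⟨N.toList.length, by simp [st_none]⟩, ?_, ?_, ?_, ?_, ?_⟩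
  · rintro (_ | a) k hu y hy
    · exact Finset.mem_union_right _ (mem_N k y hy)
    · exact Finset.mem_union_left _ (mem_C a (hu a rfl) k y hy)
  · rw [st_none, List.getElem?_eq_getElem hlen]
    simp
  · rintro (_ | a) (_ | b) k l hu hv h
    · rfl
    · exact (st_ne b (hv b rfl) l k h.symm).elim
    · exact (st_ne a (hu a rfl) k l h).elim
    · rw [inj_some a (hu a rfl) b (hv b rfl) k l h]
  · rintro (_ | a) hu h
    · rw [st_none, st_none] at h
      exact absurd ((List.getElem?_inj hlen N.nodup_toList).1 h) zero_ne_one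
    · rw [st_some, st_some] at h
      simp only [if_true, one_ne_zero, if_false] at h
      exact hcA a (hu a rfl) (Option.some.inj h ▸ hu a rfl)
  · intro k
    obtain ⟨g, hg1, hg2⟩ := hc (A.filter fun a => k a ≠ 0) (Finset.filter_subset _ _)
    refine ⟨g, fun a ha => ?_⟩
    rw [st_some]
    split_ifs with h
    · rw [hg2 a ha (by simp [h])]
    · rw [hg1 a (by simp [ha, h])]
  · intro g
    obtain ⟨g', h1, h2⟩ := hA₁ g
    refine ⟨g', fun a ha k y hy => h1 y (mem_C a ha k y hy), fun m hm => ?_⟩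
    by_cases h : g'.symm m ∈ C
    · exact Finset.mem_union_left _ h
    · exact Finset.mem_union_right _
        (Finset.mem_sdiff.2 ⟨Finset.mem_insert_of_mem (h2 m hm), h⟩)
  · intro a ha
    rcases Finset.mem_union.1 ha with ha | ha
    · rcases Finset.mem_union.1 ha with ha | ha
      · exact ⟨some a, 0, fun b hb => by cases hb; exact ha, rfl⟩
      · obtain ⟨b, hb, rfl⟩ := Finset.mem_image.1 ha
        exact ⟨some b, 1, fun b' hb' => by cases hb'; exact hb, by rw [st_some]; simp⟩
    · obtain ⟨k, hk⟩ := List.mem_iff_getElem?.1 (Finset.mem_toList.2 ha)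
      exact ⟨none, k, by simp, hk⟩

/-- A sequence of branching steps that starts with the empty level and takes care of all the
finite sets `E s`. -/
theorem HasTrivialDcl.exists_levels [Infinite M] (hM : HasTrivialDcl L M) (E : ℕ → Finset M) :
    ∃ (A : ℕ → Finset M) (st : ℕ → Option M → ℕ → Option M), A 0 = ∅ ∧
      ∀ s, IsLevelStep L (A s) (E s) (A (s + 1)) (st s) := by
  choose A' st h using fun (s : ℕ) (A : Finset M) => hM.exists_isLevelStep A (E s)
  let A : ℕ → Finset M := fun s => Nat.rec ∅ (fun s A => A' s A) s
  exact ⟨A, fun s => st s (A s), rfl, fun s => h s (A s)⟩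

/-- The node at level `s` on the branch coded by `x`. -/
def node (st : ℕ → Option M → ℕ → Option M) (x : ℕ → ℕ) : ℕ → Option M
  | 0 => none
  | s + 1 => st s (node st x s) (x s)

/-! ### Branches of the tree -/

section Node

variable {A E : ℕ → Finset M} {st : ℕ → Option M → ℕ → Option M}

theorem node_mem (hst : ∀ s, IsLevelStep L (A s) (E s) (A (s + 1)) (st s)) (x : ℕ → ℕ) (s : ℕ) :
    ∀ a ∈ node st x s, a ∈ A s := by
  induction s with
  | zero => intro a ha; cases ha
  | succ s ih => exact (hst s).mem _ _ ih

theorem node_ne_none_of_le (hst : ∀ s, IsLevelStep L (A s) (E s) (A (s + 1)) (st s))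
    (x : ℕ → ℕ) {s t : ℕ} (hs : s ≤ t) (h : node st x s ≠ none) : node st x t ≠ none := by
  induction t, hs using Nat.le_induction with
  | base => exact h
  | succ t _ ih =>
    obtain ⟨a, ha⟩ := Option.ne_none_iff_exists'.1 ih
    obtain ⟨g, hg⟩ := (hst t).coherent fun _ => x t
    rw [node, ha, hg a (node_mem hst x t a ha)]
    simp

theorem node_ne_none (hst : ∀ s, IsLevelStep L (A s) (E s) (A (s + 1)) (st s))
    {x : ℕ → ℕ} {s : ℕ} (h : x s = 0) : node st x (s + 1) ≠ none := by
  by_cases h0 : node st x s = none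
  · rw [node, h0, h]
    exact (hst s).none_zero
  · exact node_ne_none_of_le hst x s.le_succ h0

theorem node_ne_of_le (hst : ∀ s, IsLevelStep L (A s) (E s) (A (s + 1)) (st s))
    (x y : ℕ → ℕ) {s t : ℕ} (hs : s ≤ t) (h : node st x s ≠ node st y s) :
    node st x t ≠ node st y t := by
  induction t, hs using Nat.le_induction with
  | base => exact h
  | succ t _ ih =>
    exact fun h' => ih ((hst t).inj _ _ _ _ (node_mem hst x t) (node_mem hst y t) h')

theorem node_ne (hst : ∀ s, IsLevelStep L (A s) (E s) (A (s + 1)) (st s))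
    {x y : ℕ → ℕ} {s : ℕ} (hx : x s = 0) (hy : y s = 1) :
    node st x (s + 1) ≠ node st y (s + 1) := by
  by_cases h : node st x s = node st y s
  · rw [node, node, h, hx, hy]
    exact (hst s).sep _ (node_mem hst y s)
  · exact node_ne_of_le hst x y s.le_succ h

/-- The word is found by retracing parents: `surj` gives the parent of an element, `none_none` lets
a branch wait at `none`, and level 0 contains only `none`. -/
theorem exists_forall_node_eq (h0 : A 0 = ∅)
    (hst : ∀ s, IsLevelStep L (A s) (E s) (A (s + 1)) (st s)) (s : ℕ) (u : Option M)
    (hu : ∀ a ∈ u, a ∈ A s) :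
    ∃ p : ℕ → ℕ, ∀ x : ℕ → ℕ, (∀ t < s, x t = p t) → node st x s = u := by
  induction s generalizing u with
  | zero =>
    rcases u with _ | a
    · exact ⟨0, fun _ _ => rfl⟩
    · exact absurd (hu a rfl) (by simp [h0])
  | succ s ih =>
    obtain ⟨v, k, hv, hk⟩ : ∃ v k, (∀ b ∈ v, b ∈ A s) ∧ st s v k = u := by
      rcases u with _ | a
      · obtain ⟨k, hk⟩ := (hst s).none_none
        exact ⟨none, k, by simp, hk⟩
      · exact (hst s).surj a (hu a rfl)
    obtain ⟨p, hp⟩ := ih v hv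
    refine ⟨Function.update p s k, fun x hx => ?_⟩
    rw [node, hp x fun t ht => ?_, hx s s.lt_succ_self, Function.update_self, hk]
    rw [hx t (ht.trans s.lt_succ_self), Function.update_of_ne ht.ne]

/-- At each level any simultaneous choice of children is realised by one automorphism; these are
composed from `s` to `t`. -/
theorem exists_coherent (hst : ∀ s, IsLevelStep L (A s) (E s) (A (s + 1)) (st s))
    (x : ℕ → ℕ → ℕ) (I : Finset ℕ) {s : ℕ} (hs : ∀ i ∈ I, node st (x i) s ≠ none)
    (hI : ∀ i ∈ I, ∀ j ∈ I, i ≠ j → node st (x i) s ≠ node st (x j) s) {t : ℕ} (hst' : s ≤ t) :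
    ∃ g : M ≃[L] M, ∀ i ∈ I, node st (x i) t = (node st (x i) s).map g := by
  classical
  induction t, hst' using Nat.le_induction with
  | base => exact ⟨Equiv.refl L M, fun i _ => by
      cases node st (x i) s <;> rfl⟩
  | succ t hle ih =>
    obtain ⟨g, hg⟩ := ih
    -- No two branches in `I` share a node, so the child index is a function of the node.
    let k : M → ℕ := fun a =>
      if h : ∃ i ∈ I, node st (x i) t = some a then x h.choose t else 0
    obtain ⟨h, hh⟩ := (hst t).coherent k
    refine ⟨h.comp g, fun i hi => ?_⟩
    obtain ⟨a, ha⟩ := Option.ne_none_iff_exists'.1 (node_ne_none_of_le hst (x i) hle (hs i hi))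
    have hk : k a = x i t := by
      have hex : ∃ i ∈ I, node st (x i) t = some a := ⟨i, hi, ha⟩
      have hc := hex.choose_spec
      simp only [k, dif_pos hex]
      by_contra hne
      exact node_ne_of_le hst (x _) (x i) hle
        (hI _ hc.1 i hi (fun h => hne (by rw [h]))) (hc.2.trans ha.symm)
    have h1 := hh a (node_mem hst (x i) t a ha)
    rw [hk] at h1
    rw [node, ha, h1]
    have h2 := hg i hi
    rw [ha] at h2
    obtain ⟨b, hb⟩ := Option.ne_none_iff_exists'.1 (hs i hi)
    rw [hb] at h2 ⊢
    cases h2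
    rfl

end Node

end Levels

end FirstOrder.Language

namespace FirstOrder.Language

/-! ### Back-and-forth -/

section BackAndForth

/-- A back-and-forth system of finite partial bijections between countable sets has a limit. -/
theorem exists_equiv_of_backAndForth {α β : Type*} [Countable α] [Countable β] [DecidableEq α]
    [DecidableEq β] (P : Finset (α × β) → Prop) (h0 : P ∅)
    (hmono : ∀ S T, S ⊆ T → P T → P S)
    (forth : ∀ S, P S → ∀ a, ∃ b, P (insert (a, b) S))
    (back : ∀ S, P S → ∀ b, ∃ a, P (insert (a, b) S))
    (functional : ∀ a b b', P {(a, b), (a, b')} → b = b')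
    (injective : ∀ a a' b, P {(a, b), (a', b)} → a = a') :
    ∃ f : α ≃ β, ∀ F : Finset α, P (F.image fun a => (a, f a)) := by
  obtain ⟨p, hp⟩ := Countable.exists_injective_nat α
  obtain ⟨q, hq⟩ := Countable.exists_injective_nat β
  have step : ∀ (n : ℕ) (S : {S : Finset (α × β) // P S}), ∃ T : {T : Finset (α × β) // P T},
      S.1 ⊆ T.1 ∧ (∀ a, p a = n → ∃ b, (a, b) ∈ T.1) ∧ ∀ b, q b = n → ∃ a, (a, b) ∈ T.1 := by
    rintro n ⟨S, hS⟩
    obtain ⟨T, hT, hST, h1⟩ : ∃ T, P T ∧ S ⊆ T ∧ ∀ a, p a = n → ∃ b, (a, b) ∈ T := by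
      by_cases h : ∃ a, p a = n
      · obtain ⟨a, rfl⟩ := h
        obtain ⟨b, hb⟩ := forth S hS a
        refine ⟨_, hb, Finset.subset_insert _ _, fun a' ha' => ⟨b, ?_⟩⟩
        rw [hp ha']
        exact Finset.mem_insert_self _ _
      · exact ⟨S, hS, subset_rfl, fun a ha => (h ⟨a, ha⟩).elim⟩
    by_cases h : ∃ b, q b = n
    · obtain ⟨b, rfl⟩ := h
      obtain ⟨a, ha⟩ := back T hT b
      refine ⟨⟨_, ha⟩, hST.trans (Finset.subset_insert _ _), fun a' ha' => ?_,
        fun b' hb' => ⟨a, ?_⟩⟩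
      · obtain ⟨b', hb'⟩ := h1 a' ha'
        exact ⟨b', Finset.mem_insert_of_mem hb'⟩
      · rw [hq hb']
        exact Finset.mem_insert_self _ _
    · exact ⟨⟨T, hT⟩, hST, h1, fun b hb => (h ⟨b, hb⟩).elim⟩
  choose st hsub hdom hcod using step
  let C : ℕ → {S : Finset (α × β) // P S} := fun n => Nat.rec ⟨∅, h0⟩ (fun n S => st n S) n
  have hC : ∀ n, C (n + 1) = st n (C n) := fun _ => rfl
  have mono : Monotone fun n => (C n).1 := monotone_nat_of_le_succ fun n => hsub n (C n)
  have hf : ∀ a, ∃ b, ∃ n, (a, b) ∈ (C n).1 := fun a => by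
    obtain ⟨b, hb⟩ := hdom (p a) (C (p a)) a rfl
    exact ⟨b, p a + 1, hb⟩
  have hg : ∀ b, ∃ a, ∃ n, (a, b) ∈ (C n).1 := fun b => by
    obtain ⟨a, ha⟩ := hcod (q b) (C (q b)) b rfl
    exact ⟨a, q b + 1, ha⟩
  have pair : ∀ x y, (∃ n, x ∈ (C n).1) → (∃ n, y ∈ (C n).1) → P {x, y} := by
    rintro x y ⟨n, hx⟩ ⟨m, hy⟩
    refine hmono _ _ ?_ (C (max n m)).2
    intro z hz
    rcases Finset.mem_insert.1 hz with rfl | hz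
    · exact mono (le_max_left n m) hx
    · rw [Finset.mem_singleton.1 hz]
      exact mono (le_max_right n m) hy
  choose f hf using hf
  have hbij : Function.Bijective f := by
    refine ⟨fun a a' h => ?_, fun b => ?_⟩
    · refine injective a a' (f a) (pair _ _ (hf a) ?_)
      rw [h]
      exact hf a'
    · obtain ⟨a, ha⟩ := hg b
      exact ⟨a, functional a _ _ (pair _ _ (hf a) ha)⟩
  refine ⟨Equiv.ofBijective f hbij, fun F => ?_⟩
  choose n hn using hf
  refine hmono _ _ ?_ (C (F.sup n)).2
  intro x hx
  obtain ⟨a, ha, rfl⟩ := Finset.mem_image.1 hx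
  exact mono (Finset.le_sup ha) (hn a)

end BackAndForth

/-! ### Limits of labellings and their isomorphism with `M` -/

section Approximation

open Filter

variable {L : Language.{u, v}} {M : Type w} [L.Structure M]

/-- A sequence of maps `ℕ → M` which, on every finite set, is eventually injective and eventually
constant up to automorphisms, and whose limit type has the extension property of `M`. -/
structure IsApproximation (L : Language.{u, v}) {M : Type w} [L.Structure M] (e : ℕ → ℕ → M) :
    Prop where
  injective : ∀ i j, i ≠ j → ∀ᶠ s in atTop, e s i ≠ e s j
  coherent : ∀ n, ∀ᶠ s in atTop, ∀ t ≥ s, ∃ g : M ≃[L] M, ∀ i < n, g (e s i) = e t i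
  extend : ∀ n (d : ℕ → M) (m : M), (∀ᶠ s in atTop, ∃ g : M ≃[L] M, ∀ i < n, g (e s i) = d i) →
    ∃ k, ∀ᶠ s in atTop, ∃ g : M ≃[L] M, (∀ i < n, g (e s i) = d i) ∧ g (e s k) = m

theorem IsApproximation.exists_equiv [Countable M] {e : ℕ → ℕ → M} (he : IsApproximation L e) :
    ∃ f : ℕ ≃ M, ∀ n, ∀ᶠ s in atTop, ∃ g : M ≃[L] M, ∀ i < n, g (e s i) = f i := by
  classical
  let P : Finset (ℕ × M) → Prop := fun S =>
    ∀ᶠ s in atTop, ∃ g : M ≃[L] M, ∀ x ∈ S, g (e s x.1) = x.2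
  -- Freezing the labels at one late level gives values on a whole initial segment; coherence keeps
  -- this assignment realised at all later levels.
  have key : ∀ S, P S → ∀ N, ∃ (n : ℕ) (d : ℕ → M), N < n ∧ (∀ x ∈ S, x.1 < n ∧ d x.1 = x.2) ∧
      ∀ᶠ s in atTop, ∃ g : M ≃[L] M, ∀ i < n, g (e s i) = d i := by
    intro S hS N
    let n := max N (S.sup Prod.fst) + 1
    obtain ⟨s, ⟨g, hg⟩, hs⟩ := (hS.and (he.coherent n)).exists
    refine ⟨n, fun i => g (e s i), Nat.lt_succ_of_le (le_max_left _ _), fun x hx =>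
      ⟨Nat.lt_succ_of_le ((Finset.le_sup (f := Prod.fst) hx).trans (le_max_right _ _)), hg x hx⟩, ?_⟩
    filter_upwards [eventually_ge_atTop s] with t ht
    obtain ⟨h, hh⟩ := hs t ht
    refine ⟨g.comp h.symm, fun i hi => ?_⟩
    rw [Equiv.comp_apply, ← hh i hi, Equiv.symm_apply_apply]
  have main : ∃ f : ℕ ≃ M, ∀ F : Finset ℕ, P (F.image fun i => (i, f i)) := by
    refine exists_equiv_of_backAndForth P ?_ ?_ ?_ ?_ ?_ ?_
    · exact Eventually.of_forall fun s => ⟨Equiv.refl L M, by simp⟩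
    · intro S T hST hT
      exact hT.mono fun s ⟨g, hg⟩ => ⟨g, fun x hx => hg x (hST hx)⟩
    · intro S hS i
      obtain ⟨n, d, hn, hd, h⟩ := key S hS i
      refine ⟨d i, h.mono ?_⟩
      rintro s ⟨g, hg⟩
      refine ⟨g, fun x hx => ?_⟩
      rcases Finset.mem_insert.1 hx with rfl | hx
      · exact hg i hn
      · rw [hg _ (hd x hx).1, (hd x hx).2]
    · intro S hS m
      obtain ⟨n, d, -, hd, h⟩ := key S hS 0
      obtain ⟨k, hk⟩ := he.extend n d m h
      refine ⟨k, hk.mono ?_⟩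
      rintro s ⟨g, hg, hgk⟩
      refine ⟨g, fun x hx => ?_⟩
      rcases Finset.mem_insert.1 hx with rfl | hx
      · exact hgk
      · rw [hg _ (hd x hx).1, (hd x hx).2]
    · intro i m m' h
      obtain ⟨s, g, hg⟩ := h.exists
      exact (hg (i, m) (by simp)).symm.trans (hg (i, m') (by simp))
    · intro i j m h
      by_contra hij
      obtain ⟨s, ⟨g, hg⟩, hs⟩ := (h.and (he.injective i j hij)).exists
      exact hs (g.injective ((hg (i, m) (by simp)).trans (hg (j, m) (by simp)).symm))
  obtain ⟨f, hf⟩ := main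
  refine ⟨f, fun n => (hf (Finset.range n)).mono ?_⟩
  rintro s ⟨g, hg⟩
  exact ⟨g, fun i hi => hg (i, f i) (Finset.mem_image.2 ⟨i, Finset.mem_range.2 hi, rfl⟩)⟩

/-- The limit on `ℕ` of the structures induced by a sequence of maps `ℕ → M`, for a structure `M`
in which the value of a function is always one of its arguments. -/
noncomputable def limitStructure (L : Language.{u, v}) {M : Type w} [L.Structure M]
    (hL : ∀ {k}, L.Functions k → Nonempty (Fin k)) (e : ℕ → ℕ → M) : StructureSpace L :=
  ({ funMap := fun f x => x (@Classical.epsilon _ (hL f) fun i =>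
        ∀ᶠ s in atTop, Structure.funMap f (e s ∘ x) = e s (x i))
     RelMap := fun R x => ∀ᶠ s in atTop, Structure.RelMap R (e s ∘ x) } : L.Structure ℕ)

/-- The function value is chosen as an argument position, from a predicate on `Fin k` that does not
see the names of the points. Equivariance is therefore exact for every `e`, convergent or not. -/
theorem smul_limitStructure (hL : ∀ {k}, L.Functions k → Nonempty (Fin k)) (e : ℕ → ℕ → M)
    (σ : Equiv.Perm ℕ) :
    σ • limitStructure L hL e = limitStructure L hL fun s i => e s (σ.symm i) := by
  refine Structure.ext ?_ rfl
  funext k f x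
  exact σ.apply_symm_apply _

theorem IsApproximation.exists_limitStructure_equiv [Countable M] (hM : HasTrivialDcl L M)
    (hL : ∀ {k}, L.Functions k → Nonempty (Fin k)) {e : ℕ → ℕ → M} (he : IsApproximation L e) :
    letI : L.Structure ℕ := limitStructure L hL e
    ∃ f : ℕ ≃[L] M, ∀ n, ∀ᶠ s in atTop, ∃ g : M ≃[L] M, ∀ i < n, g (e s i) = f i := by
  obtain ⟨f, hf⟩ := he.exists_equiv
  have key : ∀ {k} (x : Fin k → ℕ), ∃ n, ∀ i, x i < n := fun x =>
    ⟨Finset.univ.sup x + 1, fun i => Nat.lt_succ_of_le (Finset.le_sup (Finset.mem_univ i))⟩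
  refine ⟨@Language.Equiv.mk L ℕ M (limitStructure L hL e) _ f ?_ ?_, hf⟩
  · intro k F x
    obtain ⟨n, hn⟩ := key x
    obtain ⟨s, hs, -⟩ := ((he.coherent n).and (he.coherent n)).exists
    obtain ⟨i, hi⟩ := hM.funMap_mem_range F (e s ∘ x)
    -- A position that is correct at level `s` stays correct, since an automorphism carries the
    -- labels at `s` to those at `t`.
    have hex : ∃ i, ∀ᶠ s in atTop, Structure.funMap F (e s ∘ x) = e s (x i) := by
      refine ⟨i, (eventually_ge_atTop s).mono fun t ht => ?_⟩
      obtain ⟨g, hg⟩ := hs t ht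
      have : e t ∘ x = g ∘ (e s ∘ x) := funext fun j => (hg _ (hn j)).symm
      rw [this, ← g.map_fun, ← hi]
      exact hg _ (hn i)
    obtain ⟨t, ht, g, hg⟩ := ((Classical.epsilon_spec hex).and (hf n)).exists
    have h2 : f ∘ x = g ∘ (e t ∘ x) := funext fun j => (hg _ (hn j)).symm
    change f (x _) = Structure.funMap F (f ∘ x)
    rw [h2, ← g.map_fun, ht, hg _ (hn _)]
  · intro k R x
    obtain ⟨n, hn⟩ := key x
    have h1 : ∀ᶠ s in atTop, (Structure.RelMap R (f ∘ x) ↔ Structure.RelMap R (e s ∘ x)) := by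
      refine (hf n).mono ?_
      rintro s ⟨g, hg⟩
      have h2 : f ∘ x = g ∘ (e s ∘ x) := funext fun j => (hg _ (hn j)).symm
      rw [h2, g.map_rel]
    change Structure.RelMap R (f ∘ x) ↔ ∀ᶠ s in atTop, Structure.RelMap R (e s ∘ x)
    constructor
    · exact fun h => h1.mono fun s hs => hs.1 h
    · intro h
      obtain ⟨s, hs, hs'⟩ := (h1.and h).exists
      exact hs.2 hs'

/-! ### Measurability of the limit structure -/

section Measurability

open MeasureTheory

theorem StructureSpace.measurable_of {α : Type*} [MeasurableSpace α] {Φ : α → StructureSpace L}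
    (hR : ∀ {k} (R : L.Relations k) (x : Fin k → ℕ),
      MeasurableSet {a | @Structure.RelMap L ℕ (Φ a) k R x})
    (hf : ∀ {k} (f : L.Functions k) (x : Fin k → ℕ) (l : ℕ),
      MeasurableSet {a | @Structure.funMap L ℕ (Φ a) k f x = l}) : Measurable Φ := by
  refine measurable_generateFrom ?_
  rintro _ (⟨k, R, x, rfl⟩ | ⟨k, f, x, l, rfl⟩)
  · exact hR R x
  · exact hf f x l

theorem StructureSpace.measurable_perm_smul (σ : Equiv.Perm ℕ) :
    Measurable fun 𝒩 : StructureSpace L => σ • 𝒩 := by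
  refine StructureSpace.measurable_of (fun {k} R x => ?_) (fun {k} f x l => ?_)
  · exact MeasurableSpace.measurableSet_generateFrom
      (Or.inl ⟨k, R, fun i => σ.symm (x i), rfl⟩)
  · refine MeasurableSpace.measurableSet_generateFrom
      (Or.inr ⟨k, f, fun i => σ.symm (x i), σ.symm l, ?_⟩)
    ext 𝒩
    exact σ.eq_symm_apply.symm

/-- This is the condition on the target space in the Lusin–Souslin theorem, and the place where
countability of the language enters. -/
instance StructureSpace.countablySeparated [Countable L.Symbols] :
    MeasurableSpace.CountablySeparated (StructureSpace L) := by
  have hF : Countable (Σ k, L.Functions k) :=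
    (Sum.inl_injective (β := Σ k, L.Relations k)).countable (f := fun x => (Sum.inl x : L.Symbols))
  have hR : Countable (Σ k, L.Relations k) :=
    (Sum.inr_injective (α := Σ k, L.Functions k)).countable (f := fun x => (Sum.inr x : L.Symbols))
  have h1 : MeasurableSpace.CountablyGenerated (StructureSpace L) := by
    refine ⟨_, Set.Countable.union ?_ ?_, rfl⟩
    · have : ∀ k, Countable (L.Relations k) := fun k => (sigma_mk_injective (i := k)).countable
      refine (Set.countable_range fun y : Σ k, L.Relations k × (Fin k → ℕ) =>
        {𝒩 : StructureSpace L | @Structure.RelMap L ℕ 𝒩 y.1 y.2.1 y.2.2}).mono ?_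
      rintro _ ⟨k, R, n, rfl⟩
      exact ⟨⟨k, R, n⟩, rfl⟩
    · have : ∀ k, Countable (L.Functions k) := fun k => (sigma_mk_injective (i := k)).countable
      refine (Set.countable_range fun y : Σ k, L.Functions k × (Fin k → ℕ) × ℕ =>
        {𝒩 : StructureSpace L |
          @Structure.funMap L ℕ 𝒩 y.1 y.2.1 y.2.2.1 = y.2.2.2}).mono ?_
      rintro _ ⟨k, f, n, l, rfl⟩
      exact ⟨⟨k, f, n, l⟩, rfl⟩
  have h2 : MeasurableSpace.SeparatesPoints (StructureSpace L) := by
    refine ⟨fun 𝒩 𝒩' h => Structure.ext ?_ ?_⟩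
    · funext k f x
      exact (h _ (MeasurableSpace.measurableSet_generateFrom (Or.inr ⟨k, f, x, _, rfl⟩)) rfl).symm
    · funext k R x
      refine propext ⟨fun hx => h _
        (MeasurableSpace.measurableSet_generateFrom (Or.inl ⟨k, R, x, rfl⟩)) hx, fun hx => ?_⟩
      by_contra hn
      exact h _ (MeasurableSpace.measurableSet_generateFrom (Or.inl ⟨k, R, x, rfl⟩)).compl hn hx
  infer_instance

theorem measurable_limitStructure [Countable M] [MeasurableSpace M] [DiscreteMeasurableSpace M]
    (hL : ∀ {k}, L.Functions k → Nonempty (Fin k)) :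
    Measurable (limitStructure L hL : (ℕ → ℕ → M) → StructureSpace L) := by
  have hm : ∀ {k} (x : Fin k → ℕ) (s : ℕ), Measurable fun e : ℕ → ℕ → M => e s ∘ x := by
    intro k x s
    refine measurable_pi_lambda _ fun i => ?_
    exact (measurable_pi_apply (x i)).comp (measurable_pi_apply s)
  have hev : ∀ p : ℕ → (ℕ → ℕ → M) → Prop, (∀ s, MeasurableSet {e | p s e}) →
      MeasurableSet {e | ∀ᶠ s in atTop, p s e} := by
    intro p hp
    simp only [eventually_atTop, Set.ofPred_exists, Set.ofPred_forall]
    exact MeasurableSet.iUnion fun a => MeasurableSet.iInter fun b => MeasurableSet.iInter fun _ =>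
      hp b
  refine StructureSpace.measurable_of (fun R x => ?_) (fun {k} f x l => ?_)
  · exact hev _ fun s => hm x s (Set.to_countable {y | Structure.RelMap R y}).measurableSet
  · let p : (ℕ → ℕ → M) → (Fin k → Prop) := fun e i =>
      ∀ᶠ s in atTop, Structure.funMap f (e s ∘ x) = e s (x i)
    have hp : Measurable p := by
      refine measurable_pi_lambda _ fun i => measurableSet_setOfPred.1 (hev _ fun s => ?_)
      exact hm x s (Set.to_countable {y | Structure.funMap f y = y i}).measurableSet
    exact hp (Set.to_countable {q : Fin k → Prop |
      x (@Classical.epsilon _ (hL f) q) = l}).measurableSet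

end Measurability

end Approximation

end FirstOrder.Language

namespace FirstOrder.Language

/-! ### The isomorphism class is Borel -/

section IsoClass

open Filter MeasureTheory

variable {L : Language.{u, v}} {M : Type w} [L.Structure M]

theorem isApproximation_const {e : ℕ → M} (hinj : Function.Injective e)
    (hext : ∀ n m, ∃ k, ∃ g : M ≃[L] M, (∀ i < n, g (e i) = e i) ∧ g (e k) = m) :
    IsApproximation L fun _ => e where
  injective i j hij := Eventually.of_forall fun _ => hinj.ne hij
  coherent n := Eventually.of_forall fun _ _ _ => ⟨Equiv.refl L M, fun _ _ => rfl⟩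
  extend n d m h := by
    obtain ⟨_, g₀, hg₀⟩ := h.exists
    obtain ⟨k, g, hg, hgk⟩ := hext n (g₀.symm m)
    refine ⟨k, Eventually.of_forall fun _ => ⟨g₀.comp g, fun i hi => ?_, ?_⟩⟩
    · rw [Equiv.comp_apply, hg i hi, hg₀ i hi]
    · rw [Equiv.comp_apply, hgk, Equiv.apply_symm_apply]

/-- The maps `e : ℕ → M` which have the type of an enumeration of `M`, and whose values are
successively chosen least (with respect to `q`) among their conjugates. -/
def canonicalMaps (L : Language.{u, v}) {M : Type w} [L.Structure M] (q : M → ℕ) : Set (ℕ → M) :=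
  {e | Function.Injective e ∧
    (∀ n m, ∃ k, ∃ g : M ≃[L] M, (∀ i < n, g (e i) = e i) ∧ g (e k) = m) ∧
    ∀ n, ∀ g : M ≃[L] M, (∀ i < n, g (e i) = e i) → q (e n) ≤ q (g (e n))}

/-- There are only countably many restrictions to the first `N` coordinates. Conditions that
quantify over the possibly uncountable automorphism group thus become Borel. -/
theorem measurableSet_of_forall_lt [Countable M] [MeasurableSpace M] [DiscreteMeasurableSpace M]
    (Q : (ℕ → M) → Prop) (N : ℕ) (hQ : ∀ e e' : ℕ → M, (∀ i < N, e i = e' i) → Q e → Q e') :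
    MeasurableSet {e | Q e} := by
  let r : (ℕ → M) → (Fin N → M) := fun e i => e i
  have hr : Measurable r := measurable_pi_lambda _ fun i => measurable_pi_apply _
  have : {e | Q e} = r ⁻¹' (r '' {e | Q e}) := by
    refine (Set.subset_preimage_image _ _).antisymm ?_
    rintro e ⟨e', he', h⟩
    exact hQ e' e (fun i hi => congrFun h ⟨i, hi⟩) he'
  rw [this]
  exact hr (Set.to_countable _).measurableSet

theorem measurableSet_canonicalMaps [Countable M] [MeasurableSpace M] [DiscreteMeasurableSpace M]
    (q : M → ℕ) : MeasurableSet (canonicalMaps L q) := by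
  refine MeasurableSet.inter (s₁ := {e | Function.Injective e}) ?_
    (MeasurableSet.inter (s₁ := {e : ℕ → M | ∀ n m, ∃ k, ∃ g : M ≃[L] M,
      (∀ i < n, g (e i) = e i) ∧ g (e k) = m}) ?_ ?_)
  · have : {e : ℕ → M | Function.Injective e} = ⋂ i, ⋂ j, {e | e i = e j → i = j} := by
      ext e
      simp [Function.Injective]
    rw [this]
    refine MeasurableSet.iInter fun i => MeasurableSet.iInter fun j =>
      measurableSet_of_forall_lt _ (max i j + 1) fun e e' h he => ?_
    rwa [← h i (by omega), ← h j (by omega)]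
  · rw [Set.ofPred_forall]
    refine MeasurableSet.iInter fun n => ?_
    rw [Set.ofPred_forall]
    refine MeasurableSet.iInter fun m => ?_
    rw [Set.ofPred_exists]
    refine MeasurableSet.iUnion fun k => measurableSet_of_forall_lt _ (max n k + 1) ?_
    rintro e e' h ⟨g, hg, hgk⟩
    refine ⟨g, fun i hi => ?_, ?_⟩
    · rw [← h i (by omega), hg i hi]
    · rw [← h k (by omega), hgk]
  · refine (?_ : MeasurableSet {e : ℕ → M | ∀ n, ∀ g : M ≃[L] M,
      (∀ i < n, g (e i) = e i) → q (e n) ≤ q (g (e n))})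
    rw [Set.ofPred_forall]
    refine MeasurableSet.iInter fun n => measurableSet_of_forall_lt _ (n + 1) ?_
    intro e e' h he g hg
    rw [← h n (by omega)]
    exact he g fun i hi => by rw [h i (by omega), hg i hi]

theorem exists_automorphism_apply_eq {N : Type*} [L.Structure N] (f f' : N ≃[L] M) :
    ∃ h : M ≃[L] M, ∀ x, h (f x) = f' x :=
  ⟨f'.comp f.symm, fun x => by rw [Equiv.comp_apply, Equiv.symm_apply_apply]⟩

/-- Equal structures make `e` and `e'` conjugate on every initial segment. Inductively the
conjugating automorphism fixes the earlier values, so minimality in both directions forces the next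
values to agree. -/
theorem injOn_limitStructure_const [Countable M] (hM : HasTrivialDcl L M)
    (hL : ∀ {k}, L.Functions k → Nonempty (Fin k)) {q : M → ℕ} (hq : Function.Injective q) :
    Set.InjOn (fun e : ℕ → M => limitStructure L hL fun _ => e) (canonicalMaps L q) := by
  rintro e ⟨hinj, hext, hmin⟩ e' ⟨hinj', hext', hmin'⟩ h
  have h1 := (isApproximation_const hinj hext).exists_limitStructure_equiv hM hL
  have h2 := (isApproximation_const hinj' hext').exists_limitStructure_equiv hM hL
  simp only at h
  rw [h] at h1
  obtain ⟨f, hf⟩ := h1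
  obtain ⟨f', hf'⟩ := h2
  obtain ⟨φ, hφ⟩ :=
    @exists_automorphism_apply_eq L M _ ℕ (limitStructure L hL fun _ => e') f f'
  have hconj : ∀ n, ∃ g : M ≃[L] M, ∀ i < n, g (e i) = e' i := by
    intro n
    obtain ⟨_, g, hg⟩ := (hf n).exists
    obtain ⟨_, g', hg'⟩ := (hf' n).exists
    refine ⟨g'.symm.comp (φ.comp g), fun i hi => ?_⟩
    rw [Equiv.comp_apply, Equiv.comp_apply, hg i hi, hφ, ← hg' i hi, Equiv.symm_apply_apply]
  funext n
  induction n using Nat.strong_induction_on with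
  | _ n ih =>
    obtain ⟨g, hg⟩ := hconj (n + 1)
    have hn := hg n n.lt_succ_self
    refine hq (le_antisymm ?_ ?_)
    · rw [← hn]
      exact hmin n g fun i hi => (hg i (hi.trans n.lt_succ_self)).trans (ih i hi).symm
    · rw [← (g.symm_apply_apply (e n) : _ = e n), hn]
      refine hmin' n g.symm fun i hi => ?_
      have h3 : g (e' i) = e' i := (congrArg g (ih i hi)).symm.trans (hg i (hi.trans n.lt_succ_self))
      exact (congrArg g.symm h3.symm).trans (g.symm_apply_apply _)

/-- Values are minimised greedily by successive automorphisms. The limit map need not be onto `M`,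
which is why `canonicalMaps` asks for conjugates of every element in place of surjectivity. -/
theorem exists_canonicalMap (q : M → ℕ) (f : ℕ ≃ M) :
    ∃ e ∈ canonicalMaps L q, ∀ n, ∃ g : M ≃[L] M, ∀ i < n, g (f i) = e i := by
  have step : ∀ (n : ℕ) (g : M ≃[L] M), ∃ g' : M ≃[L] M, (∀ i < n, g' (f i) = g (f i)) ∧
      ∀ h : M ≃[L] M, (∀ i < n, h (f i) = g (f i)) → q (g' (f n)) ≤ q (h (f n)) := by
    intro n g
    let S : Set (M ≃[L] M) := {h | ∀ i < n, h (f i) = g (f i)}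
    have hS : S.Nonempty := ⟨g, fun _ _ => rfl⟩
    exact ⟨Function.argminOn (fun h : M ≃[L] M => q (h (f n))) S hS,
      Function.argminOn_mem _ S hS, fun h hh =>
        Function.argminOn_le (fun h : M ≃[L] M => q (h (f n))) S hh⟩
  choose st hst hmin using step
  let γ : ℕ → (M ≃[L] M) := fun n => Nat.rec (Equiv.refl L M) st n
  have hγ : ∀ n, γ (n + 1) = st n (γ n) := fun _ => rfl
  let e : ℕ → M := fun n => γ (n + 1) (f n)
  have hγe : ∀ n, ∀ i < n, γ n (f i) = e i := by
    intro n
    induction n with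
    | zero => intro i hi; exact absurd hi (Nat.not_lt_zero i)
    | succ n ih =>
      intro i hi
      rcases Nat.lt_succ_iff_lt_or_eq.1 hi with hi | rfl
      · rw [hγ, hst n _ i hi, ih i hi]
      · rfl
  refine ⟨e, ⟨fun i j hij => ?_, fun n m => ?_, fun n g hg => ?_⟩, fun n => ⟨γ n, hγe n⟩⟩
  · rw [← hγe (max i j + 1) i (by omega), ← hγe (max i j + 1) j (by omega)] at hij
    exact f.injective ((γ (max i j + 1)).injective hij)
  -- `γ n ∘ f` is onto and takes the value `m` at `k`, while `γ t ∘ f` agrees with `e` up to and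
  -- including `k`.
  · set k := f.symm ((γ n).symm m) with hk
    set t := max n (k + 1) with ht
    refine ⟨k, (γ n).comp (γ t).symm, fun i hi => ?_, ?_⟩
    · rw [Equiv.comp_apply, ← hγe t i (by omega), Equiv.symm_apply_apply, hγe t i (by omega),
        hγe n i hi]
    · rw [Equiv.comp_apply, ← hγe t k (by omega), Equiv.symm_apply_apply, hk,
        _root_.Equiv.apply_symm_apply, Equiv.apply_symm_apply]
  · refine hmin n (γ n) (g.comp (γ (n + 1))) fun i hi => ?_
    rw [Equiv.comp_apply, hγe (n + 1) i (by omega), hg i hi, hγe n i hi]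

theorem limitStructure_const_eq (hM : HasTrivialDcl L M)
    (hL : ∀ {k}, L.Functions k → Nonempty (Fin k)) [inst : L.Structure ℕ] (f : ℕ ≃[L] M)
    {e : ℕ → M} (he : ∀ n, ∃ g : M ≃[L] M, ∀ i < n, g (f i) = e i) :
    limitStructure L hL (fun _ => e) = inst := by
  have key : ∀ {k} (x : Fin k → ℕ), ∃ g : M ≃[L] M, (∀ i, g (f (x i)) = e (x i)) := by
    intro k x
    obtain ⟨g, hg⟩ := he (Finset.univ.sup x + 1)
    exact ⟨g, fun i => hg _ (Nat.lt_succ_of_le (Finset.le_sup (Finset.mem_univ i)))⟩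
  refine Structure.ext ?_ ?_
  · funext k F x
    obtain ⟨g, hg⟩ := key x
    have h1 : e ∘ x = g ∘ (f ∘ x) := funext fun i => (hg i).symm
    obtain ⟨i, hi⟩ := hM.funMap_mem_range F (e ∘ x)
    have h2 := (Classical.epsilon_spec
      (p := fun i => ∀ᶠ _ in (atTop : Filter ℕ), Structure.funMap F (e ∘ x) = e (x i))
      ⟨i, Eventually.of_forall fun _ => hi.symm⟩).exists
    obtain ⟨_, h2⟩ := h2
    have h3 : Structure.funMap F (e ∘ x) = g (f (Structure.funMap F x)) := by
      rw [h1, ← g.map_fun, ← f.map_fun]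
    replace h2 := h3.symm.trans h2
    rw [← hg] at h2
    exact (f.injective (g.injective h2)).symm
  · funext k R x
    obtain ⟨g, hg⟩ := key x
    have h1 : e ∘ x = g ∘ (f ∘ x) := funext fun i => (hg i).symm
    refine propext ?_
    change (∀ᶠ _ in (atTop : Filter ℕ), Structure.RelMap R (e ∘ x)) ↔ _
    rw [eventually_const, h1, g.map_rel, f.map_rel]

/-- The isomorphism class of a countable structure with trivial definable closure is Borel. -/
theorem HasTrivialDcl.measurableSet_isoClass [Countable L.Symbols] [Countable M] [Infinite M]
    (hM : HasTrivialDcl L M) : MeasurableSet (StructureSpace.isoClass L M) := by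
  let _ : MeasurableSpace M := ⊤
  obtain ⟨q, hq⟩ := Countable.exists_injective_nat M
  have hL : ∀ {k}, L.Functions k → Nonempty (Fin k) := fun f => hM.nonempty_fin f
  have himage : StructureSpace.isoClass L M =
      (fun e : ℕ → M => limitStructure L hL fun _ => e) '' canonicalMaps L q := by
    ext 𝒩
    constructor
    · rintro ⟨f⟩
      let _ : L.Structure ℕ := 𝒩
      obtain ⟨e, he, h⟩ := exists_canonicalMap (L := L) q f.toEquiv
      exact ⟨e, he, limitStructure_const_eq hM hL f h⟩
    · rintro ⟨e, he, rfl⟩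
      obtain ⟨f, -⟩ := (isApproximation_const he.1 he.2.1).exists_limitStructure_equiv hM hL
      exact ⟨f⟩
  rw [himage]
  -- Lusin–Souslin: an injective measurable image of a Borel set is Borel, not merely analytic.
  refine (measurableSet_canonicalMaps q).image_of_measurable_injOn ?_
    (injOn_limitStructure_const hM hL hq)
  exact (measurable_limitStructure hL).comp (measurable_pi_lambda _ fun _ => measurable_id)

end IsoClass

end FirstOrder.Language

namespace FirstOrder.Language

/-! ### Generic branches approximate `M` -/

section Generic

open Filter

variable {L : Language.{u, v}} {M : Type w} [L.Structure M]

/-- Genericity of a sequence of branches: each branch takes the value `0`, any two of them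
differ by `0` and `1` at some place, and each finite word starts infinitely many of them. -/
structure IsGeneric (ω : ℕ × ℕ → ℕ) : Prop where
  zero : ∀ i, ∃ s, ω (i, s) = 0
  sep : ∀ i j, i ≠ j → ∃ s, ω (i, s) = 0 ∧ ω (j, s) = 1
  word : ∀ n s (p : Fin s → ℕ), ∃ i ≥ n, ∀ t : Fin s, ω (i, t) = p t

/-- The label at level `s` of the `i`-th branch coded by `ω`. -/
def nodeLabel (st : ℕ → Option M → ℕ → Option M) (m₀ : M) (ω : ℕ × ℕ → ℕ) (s i : ℕ) : M :=
  (node st (fun t => ω (i, t)) s).getD m₀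

theorem node_eq_some_nodeLabel {st : ℕ → Option M → ℕ → Option M} (m₀ : M) {ω : ℕ × ℕ → ℕ}
    {s i : ℕ} (h : node st (fun t => ω (i, t)) s ≠ none) :
    node st (fun t => ω (i, t)) s = some (nodeLabel st m₀ ω s i) := by
  obtain ⟨a, ha⟩ := Option.ne_none_iff_exists'.1 h
  rw [nodeLabel, ha, Option.getD_some]

theorem exists_coherent_nodeLabel {A E : ℕ → Finset M} {st : ℕ → Option M → ℕ → Option M}
    (hst : ∀ s, IsLevelStep L (A s) (E s) (A (s + 1)) (st s)) (m₀ : M) {ω : ℕ × ℕ → ℕ}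
    (I : Finset ℕ) {s : ℕ} (hs : ∀ i ∈ I, node st (fun t => ω (i, t)) s ≠ none)
    (hI : ∀ i ∈ I, ∀ j ∈ I, i ≠ j →
      node st (fun t => ω (i, t)) s ≠ node st (fun t => ω (j, t)) s) {t : ℕ} (hle : s ≤ t) :
    ∃ g : M ≃[L] M, ∀ i ∈ I, g (nodeLabel st m₀ ω s i) = nodeLabel st m₀ ω t i := by
  obtain ⟨g, hg⟩ := exists_coherent hst (fun i t => ω (i, t)) I hs hI hle
  refine ⟨g, fun i hi => ?_⟩
  have h := hg i hi
  rw [node_eq_some_nodeLabel m₀ (hs i hi), Option.map_some,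
    node_eq_some_nodeLabel m₀ (node_ne_none_of_le hst _ hle (hs i hi))] at h
  exact (Option.some.inj h).symm

theorem IsGeneric.isApproximation {A E : ℕ → Finset M} {st : ℕ → Option M → ℕ → Option M}
    (h0 : A 0 = ∅) (hst : ∀ s, IsLevelStep L (A s) (E s) (A (s + 1)) (st s))
    (hE : ∀ m, ∀ᶠ s in atTop, m ∈ E s) (m₀ : M) {ω : ℕ × ℕ → ℕ} (hω : IsGeneric ω) :
    IsApproximation L (nodeLabel st m₀ ω) := by
  have hsome : ∀ i, ∀ᶠ s in atTop, node st (fun t => ω (i, t)) s ≠ none := by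
    intro i
    obtain ⟨s, hs⟩ := hω.zero i
    filter_upwards [eventually_ge_atTop (s + 1)] with t ht
    exact node_ne_none_of_le hst _ ht (node_ne_none hst hs)
  have hne : ∀ i j, i ≠ j → ∀ᶠ s in atTop,
      node st (fun t => ω (i, t)) s ≠ node st (fun t => ω (j, t)) s := by
    intro i j hij
    obtain ⟨s, hi, hj⟩ := hω.sep i j hij
    filter_upwards [eventually_ge_atTop (s + 1)] with t ht
    exact node_ne_of_le hst _ _ ht (node_ne hst hi hj)
  have hgood : ∀ n, ∀ᶠ s in atTop, (∀ i ∈ Finset.range n, node st (fun t => ω (i, t)) s ≠ none) ∧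
      ∀ i ∈ Finset.range n, ∀ j ∈ Finset.range n, i ≠ j →
        node st (fun t => ω (i, t)) s ≠ node st (fun t => ω (j, t)) s := by
    intro n
    refine ((eventually_all_finset _).2 fun i _ => hsome i).and
      ((eventually_all_finset _).2 fun i _ => (eventually_all_finset _).2 fun j _ => ?_)
    by_cases hij : i = j
    · exact Eventually.of_forall fun _ h => (h hij).elim
    · exact (hne i j hij).mono fun _ h _ => h
  refine ⟨fun i j hij => ?_, fun n => ?_, fun n d m hd => ?_⟩
  · filter_upwards [hsome i, hsome j, hne i j hij] with s hi hj hs h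
    rw [node_eq_some_nodeLabel m₀ hi, node_eq_some_nodeLabel m₀ hj, h] at hs
    exact hs rfl
  · filter_upwards [hgood n] with s hs t ht
    obtain ⟨g, hg⟩ := exists_coherent_nodeLabel hst m₀ _ hs.1 hs.2 ht
    exact ⟨g, fun i hi => hg i (Finset.mem_range.2 hi)⟩
  · by_cases hm : ∃ i < n, d i = m
    · obtain ⟨i, hi, rfl⟩ := hm
      exact ⟨i, hd.mono fun s ⟨g, hg⟩ => ⟨g, hg, hg i hi⟩⟩
    have hdE : ∀ᶠ s in atTop, ∀ i ∈ Finset.range n, d i ∈ E s :=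
      (eventually_all_finset _).2 fun i _ => hE (d i)
    -- Here `g` realises `d` at level `s + 1`, because `extend` controls automorphisms on the
    -- children of the nodes of level `s`.
    obtain ⟨s, hs, ⟨g, hg⟩, hdE, hmE⟩ := ((hgood n).and
      (((tendsto_add_atTop_nat 1).eventually hd).and (hdE.and (hE m)))).exists
    obtain ⟨g', hg', hg'E⟩ := (hst s).extend g
    have hsucc : ∀ i < n, node st (fun t => ω (i, t)) (s + 1) =
        some (nodeLabel st m₀ ω (s + 1) i) := fun i hi =>
      node_eq_some_nodeLabel m₀
        (node_ne_none_of_le hst _ s.le_succ (hs.1 i (Finset.mem_range.2 hi)))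
    have hg'd : ∀ i < n, g' (nodeLabel st m₀ ω (s + 1) i) = d i := by
      intro i hi
      have hi' := Finset.mem_range.2 hi
      have hnode := node_eq_some_nodeLabel m₀ (hs.1 i hi')
      rw [← hg i hi]
      refine hg' _ (node_mem hst _ s _ hnode) (ω (i, s)) _ ?_ ?_
      · rw [← hnode]
        exact hsucc i hi
      · rw [hg i hi]
        exact hdE i hi'
    obtain ⟨p, hp⟩ := exists_forall_node_eq h0 hst (s + 1) (some (g'.symm m))
      fun a ha => by cases ha; exact hg'E m hmE
    -- Genericity provides a branch through the node labelled by the preimage of `m`. As `m` is none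
    -- of the `d i`, it is separated from the earlier branches, and coherence carries the
    -- realisation to all later levels.
    obtain ⟨k, hk, hkp⟩ := hω.word n (s + 1) fun t => p t
    have hnk : node st (fun t => ω (k, t)) (s + 1) = some (g'.symm m) :=
      hp _ fun t ht => hkp ⟨t, ht⟩
    have hlk : nodeLabel st m₀ ω (s + 1) k = g'.symm m := by rw [nodeLabel, hnk, Option.getD_some]
    have hnik : ∀ i < n, node st (fun t => ω (i, t)) (s + 1) ≠
        node st (fun t => ω (k, t)) (s + 1) := by
      intro i hi h
      rw [hsucc i hi, hnk] at h
      refine hm ⟨i, hi, ?_⟩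
      rw [← hg'd i hi, Option.some.inj h, Equiv.apply_symm_apply]
    refine ⟨k, ?_⟩
    filter_upwards [eventually_ge_atTop (s + 1)] with t ht
    obtain ⟨h, hh⟩ : ∃ h : M ≃[L] M, ∀ i ∈ insert k (Finset.range n),
        h (nodeLabel st m₀ ω (s + 1) i) = nodeLabel st m₀ ω t i := by
      refine exists_coherent_nodeLabel hst m₀ _ ?_ ?_ ht
      · intro i hi
        rcases Finset.mem_insert.1 hi with rfl | hi
        · rw [hnk]
          exact Option.some_ne_none _
        · exact node_ne_none_of_le hst _ s.le_succ (hs.1 i hi)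
      · intro i hi j hj hij
        rcases Finset.mem_insert.1 hi with rfl | hi' <;> rcases Finset.mem_insert.1 hj with rfl | hj'
        · exact (hij rfl).elim
        · exact (hnik j (Finset.mem_range.1 hj')).symm
        · exact hnik i (Finset.mem_range.1 hi')
        · exact node_ne_of_le hst _ _ s.le_succ (hs.2 i hi' j hj' hij)
    refine ⟨g'.comp h.symm, fun i hi => ?_, ?_⟩
    · rw [Equiv.comp_apply, ← hh i (Finset.mem_insert_of_mem (Finset.mem_range.2 hi)),
        Equiv.symm_apply_apply, hg'd i hi]
    · rw [Equiv.comp_apply, ← hh k (Finset.mem_insert_self _ _), Equiv.symm_apply_apply, hlk,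
        Equiv.apply_symm_apply]

end Generic

/-! ### Almost sure genericity and exchangeability -/

section Probability

open MeasureTheory ProbabilityTheory Filter

/-- A finite pattern of positive probability almost surely occurs in one of infinitely many
disjoint blocks of a sequence of independent identically distributed variables. -/
theorem ae_exists_block {ι : Type*} (ν : Measure ℕ) [IsProbabilityMeasure ν]
    (hν : ∀ n, ν {n} ≠ 0) {m : ℕ} (φ : ℕ → Fin m → ι)
    (hφ : ∀ k l s t, φ k s = φ l t → k = l ∧ s = t) (p : Fin m → ℕ) :
    ∀ᵐ ω ∂Measure.infinitePi (fun _ : ι => ν), ∃ k, ∀ t, ω (φ k t) = p t := by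
  classical
  set P := Measure.infinitePi fun _ : ι => ν
  let B : ℕ → Set (ι → ℕ) := fun k => {ω | ∀ t, ω (φ k t) = p t}
  have hB : ∀ k, MeasurableSet (B k) := by
    intro k
    have : B k = ⋂ t, {ω | ω (φ k t) = p t} := by
      ext ω
      simp [B]
    rw [this]
    exact MeasurableSet.iInter fun t => 
      (measurable_pi_apply (φ k t) : Measurable fun ω : ι → ℕ => ω (φ k t))
        (measurableSet_singleton (p t))
  have hinj : Function.Injective fun x : ℕ × Fin m => φ x.1 x.2 := fun x y h =>
    Prod.ext (hφ _ _ _ _ h).1 (hφ _ _ _ _ h).2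
  let τ : ι → Set ℕ := Function.extend (fun x : ℕ × Fin m => φ x.1 x.2) (fun x => {p x.2})
    fun _ => Set.univ
  have hτ : ∀ k t, τ (φ k t) = {p t} := fun k t => hinj.extend_apply _ _ (k, t)
  have hτm : ∀ i, MeasurableSet (τ i) := fun i => (Set.to_countable _).measurableSet
  have hPB : ∀ S : Finset ℕ, P (⋂ k ∈ S, B k) = ∏ _k ∈ S, ∏ t, ν {p t} := by
    intro S
    have : (⋂ k ∈ S, B k) =
        (((S ×ˢ (Finset.univ : Finset (Fin m))).image fun x => φ x.1 x.2 : Finset ι) :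
          Set ι).pi τ := by
      ext ω
      simp only [B, Set.mem_iInter, Set.mem_ofPred_eq, Set.mem_pi, Finset.mem_coe, Finset.mem_image,
        Finset.mem_product, Finset.mem_univ, and_true, Prod.exists]
      constructor
      · rintro h _ ⟨k, t, hk, rfl⟩
        rw [hτ]
        exact h k hk t
      · intro h k hk t
        have := h _ ⟨k, t, hk, rfl⟩
        rwa [hτ] at this
    rw [this, Measure.infinitePi_pi _ fun i _ => hτm i, Finset.prod_image fun x _ y _ h => hinj h,
      Finset.prod_product]
    simp only [hτ]
  have hPB1 : ∀ k, P (B k) = ∏ t, ν {p t} := fun k => by simpa using hPB {k}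
  have hind : iIndepSet B P := by
    rw [iIndepSet_iff_meas_biInter hB]
    intro S
    rw [hPB]
    simp only [hPB1]
  -- Second Borel–Cantelli lemma: the events are independent with the same positive probability, so
  -- the series diverges.
  have hlim : P (limsup B atTop) = 1 := by
    refine measure_limsup_eq_one hB hind ?_
    simp only [hPB1]
    exact ENNReal.tsum_const_eq_top_of_ne_zero (Finset.prod_ne_zero_iff.2 fun t _ => hν _)
  have hae : ∀ᵐ ω ∂P, ω ∈ limsup B atTop :=
    (mem_ae_iff_prob_eq_one (MeasurableSet.measurableSet_limsup hB)).2 hlim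
  filter_upwards [hae] with ω h
  rw [limsup_eq_iInf_iSup_of_nat] at h
  simp only [Set.iInf_eq_iInter, Set.iSup_eq_iUnion, Set.mem_iInter, Set.mem_iUnion] at h
  obtain ⟨k, -, hk⟩ := h 0
  exact ⟨k, hk⟩

theorem ae_isGeneric (ν : Measure ℕ) [IsProbabilityMeasure ν] (hν : ∀ n, ν {n} ≠ 0) :
    ∀ᵐ ω ∂Measure.infinitePi (fun _ : ℕ × ℕ => ν), IsGeneric ω := by
  have h1 : ∀ᵐ ω ∂Measure.infinitePi (fun _ : ℕ × ℕ => ν), ∀ i, ∃ s, ω (i, s) = 0 := by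
    refine ae_all_iff.2 fun i => ?_
    filter_upwards [ae_exists_block ν hν (fun k (_ : Fin 1) => (i, k))
      (fun k l s t h => ⟨(Prod.ext_iff.1 h).2, Subsingleton.elim _ _⟩) fun _ => 0] with ω hω
    obtain ⟨k, hk⟩ := hω
    exact ⟨k, hk 0⟩
  have h2 : ∀ᵐ ω ∂Measure.infinitePi (fun _ : ℕ × ℕ => ν), ∀ i j, i ≠ j →
      ∃ s, ω (i, s) = 0 ∧ ω (j, s) = 1 := by
    refine ae_all_iff.2 fun i => ae_all_iff.2 fun j => ?_
    by_cases hij : i = j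
    · exact Eventually.of_forall fun _ h => (h hij).elim
    filter_upwards [ae_exists_block ν hν (fun k (t : Fin 2) => (![i, j] t, k))
      (fun k l s t h => ⟨(Prod.ext_iff.1 h).2, by
        have h' := (Prod.ext_iff.1 h).1
        fin_cases s <;> fin_cases t <;> simp_all⟩) (![0, 1] : Fin 2 → ℕ) ] with ω hω _
    obtain ⟨k, hk⟩ := hω
    exact ⟨k, hk 0, hk 1⟩
  have h3 : ∀ᵐ ω ∂Measure.infinitePi (fun _ : ℕ × ℕ => ν), ∀ n s (p : Fin s → ℕ),
      ∃ i ≥ n, ∀ t : Fin s, ω (i, t) = p t := by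
    refine ae_all_iff.2 fun n => ae_all_iff.2 fun s => ae_all_iff.2 fun p => ?_
    rcases Nat.eq_zero_or_pos s with rfl | hs
    · exact Eventually.of_forall fun _ => ⟨n, le_rfl, fun t => t.elim0⟩
    filter_upwards [ae_exists_block ν hν (fun k (t : Fin s) => (n + k, (t : ℕ)))
      (fun k l s t h => ⟨Nat.add_left_cancel (Prod.ext_iff.1 h).1, Fin.ext (Prod.ext_iff.1 h).2⟩)
      p] with ω hω
    obtain ⟨k, hk⟩ := hω
    exact ⟨n + k, Nat.le_add_right _ _, hk⟩
  filter_upwards [h1, h2, h3] with ω h1 h2 h3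
  exact ⟨h1, h2, h3⟩

theorem exists_fullSupport_measure_nat :
    ∃ ν : Measure ℕ, IsProbabilityMeasure ν ∧ ∀ n, ν {n} ≠ 0 := by
  refine ⟨poissonMeasure 1, inferInstance, fun n h => ?_⟩
  have := poissonMeasure_real_singleton_pos n one_pos
  rw [measureReal_def, h] at this
  simp at this

theorem infinitePi_map_comp_perm {ι X : Type*} [MeasurableSpace X] (ν : Measure X)
    [IsProbabilityMeasure ν] (e : Equiv.Perm ι) :
    (Measure.infinitePi fun _ : ι => ν).map (fun ω i => ω (e i)) =
      Measure.infinitePi fun _ : ι => ν := by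
  have h := Measure.infinitePi_map_piCongrLeft (X := fun _ : ι => X) (fun _ => ν) e.symm
  have h' : (MeasurableEquiv.piCongrLeft (fun _ : ι => X) e.symm : (ι → X) → ι → X) =
      fun ω i => ω (e i) := by
    funext ω i
    have := MeasurableEquiv.piCongrLeft_apply_apply (β := fun _ : ι => X) e.symm ω (e i)
    rwa [_root_.Equiv.symm_apply_apply] at this
  rwa [h'] at h

variable {M : Type w}

theorem measurable_nodeLabel [Countable M] [MeasurableSpace M] [DiscreteMeasurableSpace M]
    (st : ℕ → Option M → ℕ → Option M) (m₀ : M) :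
    Measurable fun ω : ℕ × ℕ → ℕ => nodeLabel st m₀ ω := by
  refine measurable_pi_lambda _ fun s => measurable_pi_lambda _ fun i => ?_
  let _ : MeasurableSpace (Option M) := ⊤
  have h : Measurable fun ω : ℕ × ℕ → ℕ => node st (fun t => ω (i, t)) s := by
    induction s with
    | zero => exact measurable_const
    | succ s ih =>
      exact (measurable_of_countable fun y : Option M × ℕ => st s y.1 y.2).comp
        (ih.prodMk (measurable_pi_apply (i, s)))
  exact (measurable_of_countable fun y : Option M => y.getD m₀).comp h

end Probability

end FirstOrder.Language

/-! ### The invariant measure -/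

open FirstOrder.Language in
theorem mainTheorem3 (L : FirstOrder.Language.{u, v}) [Countable L.Symbols]
    (M : Type w) [L.Structure M] [Countable M] [Infinite M]
    (hM : FirstOrder.Language.HasTrivialDcl L M) :
    ∃ μ : MeasureTheory.Measure (FirstOrder.Language.StructureSpace L),
      MeasureTheory.IsProbabilityMeasure μ ∧
      MeasureTheory.SMulInvariantMeasure (Equiv.Perm ℕ)
        (FirstOrder.Language.StructureSpace L) μ ∧
      FirstOrder.Language.IsConcentratedOn μ
        (FirstOrder.Language.StructureSpace.isoClass L M) := by
  let _ : MeasurableSpace M := ⊤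
  have hL : ∀ {k}, L.Functions k → Nonempty (Fin k) := fun f => hM.nonempty_fin f
  obtain ⟨q, hq⟩ := Countable.exists_injective_nat M
  -- The default label of `none`; it has no effect on the limit for generic `ω`, since every branch
  -- eventually leaves `none` for good.
  obtain ⟨m₀⟩ : Nonempty M := inferInstance
  obtain ⟨ν, _, hν⟩ := exists_fullSupport_measure_nat
  let E : ℕ → Finset M := fun s => ((Set.finite_Iio s).preimage hq.injOn).toFinset
  have hE : ∀ m, ∀ᶠ s in Filter.atTop, m ∈ E s := fun m => by
    filter_upwards [Filter.eventually_gt_atTop (q m)] with s hs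
    simpa [E] using hs
  obtain ⟨A, st, h0, hst⟩ := hM.exists_levels E
  let P := MeasureTheory.Measure.infinitePi fun _ : ℕ × ℕ => ν
  let Φ : (ℕ × ℕ → ℕ) → StructureSpace L := fun ω => limitStructure L hL (nodeLabel st m₀ ω)
  have hΦ : Measurable Φ := (measurable_limitStructure hL).comp (measurable_nodeLabel st m₀)
  have hprob : MeasureTheory.IsProbabilityMeasure (P.map Φ) :=
    MeasureTheory.Measure.isProbabilityMeasure_map hΦ.aemeasurable
  refine ⟨P.map Φ, hprob, ⟨fun σ s hs => ?_⟩, hM.measurableSet_isoClass, ?_⟩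
  -- The permutation acts on the indices of the branches and leaves the levels alone.
  · let e : Equiv.Perm (ℕ × ℕ) := σ.symm.prodCongr (Equiv.refl ℕ)
    have hmeas : Measurable fun (ω : ℕ × ℕ → ℕ) i => ω (e i) :=
      measurable_pi_lambda _ fun i => measurable_pi_apply _
    have heq : (fun ω => σ • Φ ω) = Φ ∘ fun ω i => ω (e i) :=
      funext fun ω => smul_limitStructure hL _ σ
    rw [MeasureTheory.Measure.map_apply hΦ (StructureSpace.measurable_perm_smul σ hs),
      MeasureTheory.Measure.map_apply hΦ hs]
    change P ((fun ω => σ • Φ ω) ⁻¹' s) = _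
    rw [heq, Set.preimage_comp, ← MeasureTheory.Measure.map_apply hmeas (hΦ hs),
      infinitePi_map_comp_perm]
  · have hae : ∀ᵐ ω ∂P, Φ ω ∈ StructureSpace.isoClass L M := by
      filter_upwards [ae_isGeneric ν hν] with ω hω
      obtain ⟨f, -⟩ := (hω.isApproximation h0 hst hE m₀).exists_limitStructure_equiv hM hL
      exact ⟨f⟩
    rw [MeasureTheory.Measure.map_apply hΦ hM.measurableSet_isoClass]
    exact (MeasureTheory.mem_ae_iff_prob_eq_one (hΦ hM.measurableSet_isoClass)).1 hae
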